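/- For a finite simple graph $X$ with $n$ vertices, let $\lambda(X)=(\lambda_1(X)\ge\dots\ge\lambda_n(X))$ be the eigenvalues, with multiplicity, of its combinatorial Laplacian (degree matrix minus adjacency matrix), and for $i\ge 1$ let $d^T_i(X)$ be the number of vertices of $X$ of degree at least $i$; write $d^T(X)=(d^T_1(X),\dots,d^T_n(X))$. For non-increasing real sequences $s,t$ of length $n$, write $s\unlhd t$ if $\sum_{i=1}^k s_i\le\sum_{i=1}^k t_i$ for all $k\le n$ and $\sum_{i=1}^n s_i=\sum_{i=1}^n t_i$. **Theorem.** Let $A$ and $B$ be finite simple graphs on disjoint vertex sets $V_A$ and $V_B$, let $G=A+B$ be their disjoint sum, with vertex set $V=V_A\cup V_B$ and edge set $E_A\cup E_B$, and let $C$ be a graph on $V$ each of whose edges joins a vertex of $V_A$ to a vertex of $V_B$. Assume that $\lambda(A)\unlhd d^T(A)$, $\lambda(B)\unlhd d^T(B)$ and $\lambda(C)\unlhd d^T(C)$. Assume further that $d^T_i(C)\le d^T_i(A)$ and $d^T_i(C)\le d^T_i(B)$ for all $i\ge 1$, and that, if $C$ has at least one edge, $d^T_1(B)\le d^T_m(A)$,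 where $m$ is the maximum vertex degree of $C$ (equivalently, the largest index $i$ with $d^T_i(C)\ne 0$). Let $H=G\cup C$ be the graph on $V$ whose edges are those of $G$ and those of $C$. Then $$\lambda(H)\unlhd d^T(H).$$ -/

import Mathlib

/-- The conjugate of a finite family `p` of natural numbers:
`p^T(j)` is the number of indices `i` with `p i ≥ j` (meant for `j ≥ 1`).
It does not depend on the order in which the values of `p` are listed. -/
def conjugate {ι : Type*} [Fintype ι] (p : ι → ℕ) (j : ℕ) : ℕ :=
  (Finset.univ.filter fun i => j ≤ p i).card

/-- Majorization `s ⊴ t` of non-increasing real sequences of length `n`: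
for every `k ≤ n` the sum of the first `k` terms of `s` is at most that of `t`,
and the total sums agree. -/
def IsMajorizedBy {n : ℕ} (s t : Fin n → ℝ) : Prop :=
  (∀ k : ℕ, k ≤ n →
    ∑ i ∈ Finset.univ.filter (fun i : Fin n => (i : ℕ) < k), s i ≤
      ∑ i ∈ Finset.univ.filter (fun i : Fin n => (i : ℕ) < k), t i) ∧
  ∑ i, s i = ∑ i, t i

namespace SimpleGraph

variable {V : Type*} [Fintype V] [DecidableEq V] (G : SimpleGraph V) [DecidableRel G.Adj]

/-- The Laplacian eigenvalues `λ₁ ≥ λ₂ ≥ … ≥ λₙ` of `G`, with multiplicity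
(position `i : Fin n` holds `λ_{i+1}`). -/
noncomputable def lapSpectrum : Fin (Fintype.card V) → ℝ :=
  (G.posSemidef_lapMatrix ℝ).isHermitian.eigenvalues₀

/-- The conjugate degree sequence: `G.conjDegree j = d^T_j(G)`, the number of vertices
of degree at least `j` (for `j ≥ 1`). -/
def conjDegree {V : Type*} [Fintype V] (G : SimpleGraph V) [DecidableRel G.Adj] (j : ℕ) : ℕ :=
  conjugate (fun v => G.degree v) j

/-- The Grone–Merris majorization `λ(G) ⊴ d^T(G)`. The sequence `d^T(G)` is taken with
length `n = |V|`; its terms of index at least `n` are zero, as all degrees are below `n`. -/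
def GroneMerris : Prop :=
  IsMajorizedBy G.lapSpectrum (fun i => (G.conjDegree ((i : ℕ) + 1) : ℝ))

end SimpleGraph

/-! The Laplacian of the union is `L(A) ⊕ L(B)` plus `L(C)`. By Ky Fan, its top `k` eigenvalues sum
to at most `k` eigenvalues of the direct sum, say `a` from `A` and `b` from `B` with `a + b = k`,
plus `k` eigenvalues of `C`. The first `k` conjugate degrees sum to `∑ v, min k (deg v)`, so the
three majorizations bound this by such truncated sums at levels `a`, `b` and `k`. What remains is
the counting inequality `sum_min_union_le`, for every split `a + b = k`: degrees add in the union,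
and the conjugate-degree hypotheses let truncation levels be traded between the graphs. -/

open Finset Matrix in
/-- An orthogonal diagonalization of a real matrix with diagonal entries `μ`. -/
def IsOrthDiag {ι : Type*} [Fintype ι] [DecidableEq ι] (M : Matrix ι ι ℝ) (μ : ι → ℝ) : Prop :=
  ∃ U : Matrix ι ι ℝ, Uᵀ * U = 1 ∧ U * Uᵀ = 1 ∧ M = U * diagonal μ * Uᵀ

/-! ### Fractional weights versus subsets of fixed size -/

section Weights

variable {ι : Type*} [Fintype ι]

theorem sum_weight_le_of_threshold (f w : ι → ℝ) (S : Finset ι) (c : ℝ)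
    (hin : ∀ i ∈ S, c ≤ f i) (hout : ∀ i ∉ S, f i ≤ c)
    (h0 : ∀ i, 0 ≤ w i) (h1 : ∀ i, w i ≤ 1) (hw : ∑ i, w i = S.card) :
    ∑ i, f i * w i ≤ ∑ i ∈ S, f i := by
  classical
  have key : ∀ i, (f i - c) * w i ≤ if i ∈ S then f i - c else 0 := by
    intro i
    split_ifs with h
    · nlinarith [hin i h, h1 i]
    · nlinarith [hout i h, h0 i]
  have h := Finset.sum_le_sum fun i (_ : i ∈ Finset.univ) => key i
  rw [Finset.sum_ite_mem, Finset.univ_inter, Finset.sum_sub_distrib, Finset.sum_const,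
    nsmul_eq_mul] at h
  simp only [sub_mul, Finset.sum_sub_distrib, ← Finset.mul_sum, hw] at h
  linarith

/-- A `k`-subset maximizing the sum of `f` is separated from its complement by a threshold, since
otherwise a swap would improve it. -/
theorem exists_card_eq_sum_weight_le (f w : ι → ℝ) (k : ℕ)
    (h0 : ∀ i, 0 ≤ w i) (h1 : ∀ i, w i ≤ 1) (hw : ∑ i, w i = k) :
    ∃ S : Finset ι, S.card = k ∧ ∑ i, f i * w i ≤ ∑ i ∈ S, f i := by
  classical
  have hk : k ≤ (Finset.univ : Finset ι).card := by
    have := Finset.sum_le_sum fun i (_ : i ∈ Finset.univ) => h1 i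
    rw [hw, Finset.sum_const, nsmul_eq_mul, mul_one] at this
    exact_mod_cast this
  obtain ⟨S, hS, hmax⟩ := Finset.exists_max_image _ (fun S : Finset ι => ∑ i ∈ S, f i)
    (Finset.powersetCard_nonempty.2 hk)
  have hcard : S.card = k := (Finset.mem_powersetCard.1 hS).2
  have hswap : ∀ i ∈ S, ∀ j ∉ S, f j ≤ f i := by
    intro i hi j hj
    have hj' : j ∉ S.erase i := fun h => hj (Finset.mem_of_mem_erase h)
    have h := hmax (insert j (S.erase i)) (Finset.mem_powersetCard.2
      ⟨Finset.subset_univ _, by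
        rw [Finset.card_insert_of_notMem hj', Finset.card_erase_add_one hi, hcard]⟩)
    simp only [Finset.sum_insert hj'] at h
    linarith [Finset.add_sum_erase S f hi]
  obtain ⟨c, hin, hout⟩ : ∃ c, (∀ i ∈ S, c ≤ f i) ∧ ∀ i ∉ S, f i ≤ c := by
    rcases S.eq_empty_or_nonempty with rfl | hne
    · obtain ⟨c, hc⟩ := (Set.finite_range f).bddAbove
      exact ⟨c, by simp, fun i _ => hc ⟨i, rfl⟩⟩
    · obtain ⟨i, hi, hmin⟩ := S.exists_min_image f hne
      exact ⟨f i, hmin, fun j hj => hswap i hi j hj⟩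
  exact ⟨S, hcard, sum_weight_le_of_threshold f w S c hin hout h0 h1 (by rw [hw, hcard])⟩

theorem Fin.card_filter_val_lt_of_le {n k : ℕ} (hk : k ≤ n) :
    (Finset.univ.filter fun i : Fin n => (i : ℕ) < k).card = k := by
  rw [Fin.card_filter_val_lt, min_eq_right hk]

theorem Antitone.sum_le_sum_initial {n : ℕ} {f : Fin n → ℝ} (hf : Antitone f)
    (S : Finset (Fin n)) :
    ∑ i ∈ S, f i ≤ ∑ i ∈ Finset.univ.filter (fun i : Fin n => (i : ℕ) < S.card), f i := by
  classical
  have hS : S.card ≤ n := by simpa using S.card_le_univ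
  obtain ⟨c, hin, hout⟩ : ∃ c, (∀ i : Fin n, (i : ℕ) < S.card → c ≤ f i) ∧
      ∀ i : Fin n, ¬ (i : ℕ) < S.card → f i ≤ c := by
    rcases Nat.eq_zero_or_pos S.card with h | h
    · obtain ⟨c, hc⟩ := (Set.finite_range f).bddAbove
      exact ⟨c, by simp [h], fun i _ => hc ⟨i, rfl⟩⟩
    · refine ⟨f ⟨S.card - 1, by omega⟩, fun i hi => hf ?_, fun i hi => hf ?_⟩ <;>
        rw [Fin.le_def] <;> dsimp only <;> omega
  have h := sum_weight_le_of_threshold f (fun i => if i ∈ S then 1 else 0)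
    (Finset.univ.filter (fun i : Fin n => (i : ℕ) < S.card)) c
    (fun i hi => hin i (by simpa using hi)) (fun i hi => hout i (by simpa using hi))
    (fun i => by positivity) (fun i => by split_ifs <;> norm_num)
    (by rw [Fin.card_filter_val_lt_of_le hS]; simp)
  simpa using h

end Weights

/-! ### Ky Fan's inequality for eigenvalue sums -/

section Diagonalization

open Matrix

variable {ι κ : Type*} [Fintype ι] [DecidableEq ι] [Fintype κ] [DecidableEq κ]

theorem Matrix.IsHermitian.isOrthDiag_eigenvalues {M : Matrix ι ι ℝ} (hM : M.IsHermitian) :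
    IsOrthDiag M hM.eigenvalues := by
  have hU := hM.eigenvectorUnitary.2
  rw [Matrix.mem_unitaryGroup_iff, Matrix.star_eq_conjTranspose,
    Matrix.conjTranspose_eq_transpose_of_trivial] at hU
  refine ⟨hM.eigenvectorUnitary, mul_eq_one_comm.1 hU, hU, ?_⟩
  have h := hM.spectral_theorem
  rw [Unitary.conjStarAlgAut_apply, Matrix.star_eq_conjTranspose,
    Matrix.conjTranspose_eq_transpose_of_trivial] at h
  exact h

theorem IsOrthDiag.fromBlocks {M : Matrix ι ι ℝ} {N : Matrix κ κ ℝ} {μ : ι → ℝ} {ν : κ → ℝ}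
    (hM : IsOrthDiag M μ) (hN : IsOrthDiag N ν) :
    IsOrthDiag (Matrix.fromBlocks M 0 0 N) (Sum.elim μ ν) := by
  obtain ⟨U, hU, hU', rfl⟩ := hM
  obtain ⟨W, hW, hW', rfl⟩ := hN
  refine ⟨Matrix.fromBlocks U 0 0 W, ?_, ?_, ?_⟩
  · simp [fromBlocks_transpose, fromBlocks_multiply, hU, hW]
  · simp [fromBlocks_transpose, fromBlocks_multiply, hU', hW']
  · rw [← fromBlocks_diagonal, fromBlocks_transpose, fromBlocks_multiply, fromBlocks_multiply]
    simp

/-- Ky Fan's maximum principle, for a partial diagonal of an orthogonal conjugate. -/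
theorem IsOrthDiag.exists_sum_conj_le {M W : Matrix ι ι ℝ} {μ : ι → ℝ} (hM : IsOrthDiag M μ)
    (hW : Wᵀ * W = 1) (T : Finset ι) :
    ∃ S : Finset ι, S.card = T.card ∧ ∑ i ∈ T, (Wᵀ * M * W) i i ≤ ∑ i ∈ S, μ i := by
  obtain ⟨U, hU, hU', rfl⟩ := hM
  set Q := Uᵀ * W with hQ
  have hQQ : Qᵀ * Q = 1 := by
    rw [hQ, transpose_mul, transpose_transpose, Matrix.mul_assoc, ← Matrix.mul_assoc U, hU',
      Matrix.one_mul, hW]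
  have hQQ' : Q * Qᵀ = 1 := mul_eq_one_comm.1 hQQ
  have hconj : Wᵀ * (U * diagonal μ * Uᵀ) * W = Qᵀ * diagonal μ * Q := by
    simp only [hQ, transpose_mul, transpose_transpose, Matrix.mul_assoc]
  have hcol : ∀ i, ∑ j, Q j i ^ 2 = 1 := fun i => by
    have := congrFun (congrFun hQQ i) i
    simpa [Matrix.mul_apply, sq] using this
  have hrow : ∀ j, ∑ i, Q j i ^ 2 = 1 := fun j => by
    have := congrFun (congrFun hQQ' j) j
    simpa [Matrix.mul_apply, sq] using this
  -- The squared entries of the orthogonal `Q` are doubly stochastic, so partial row sums over `T`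
  -- are weights in `[0, 1]` of total `T.card`.
  obtain ⟨S, hS, hle⟩ := exists_card_eq_sum_weight_le μ (fun j => ∑ i ∈ T, Q j i ^ 2) T.card
    (fun j => Finset.sum_nonneg fun i _ => sq_nonneg _)
    (fun j => (Finset.sum_le_univ_sum_of_nonneg fun i => sq_nonneg _).trans_eq (hrow j))
    (by rw [Finset.sum_comm]; simp [hcol])
  refine ⟨S, hS, le_of_eq_of_le ?_ hle⟩
  simp only [Finset.mul_sum]
  rw [hconj, Finset.sum_comm]
  refine Finset.sum_congr rfl fun i _ => ?_
  rw [Matrix.mul_apply]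
  refine Finset.sum_congr rfl fun j _ => ?_
  rw [Matrix.mul_diagonal, Matrix.transpose_apply]
  ring

/-- An eigenbasis of `L` turns the sum over `T` into partial diagonals of conjugates of `M` and `N`,
to which Ky Fan applies separately. -/
theorem IsOrthDiag.exists_sum_add_le {L M N : Matrix ι ι ℝ} {μ ν ρ : ι → ℝ}
    (hM : IsOrthDiag M μ) (hN : IsOrthDiag N ν) (hL : IsOrthDiag L ρ) (hLMN : L = M + N)
    (T : Finset ι) :
    ∃ S S' : Finset ι, S.card = T.card ∧ S'.card = T.card ∧
      ∑ i ∈ T, ρ i ≤ ∑ i ∈ S, μ i + ∑ i ∈ S', ν i := by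
  obtain ⟨W, hW, -, h⟩ := hL
  obtain ⟨S, hS, hle⟩ := hM.exists_sum_conj_le hW T
  obtain ⟨S', hS', hle'⟩ := hN.exists_sum_conj_le hW T
  refine ⟨S, S', hS, hS', le_of_eq_of_le ?_ (add_le_add hle hle')⟩
  have hd : Wᵀ * M * W + Wᵀ * N * W = diagonal ρ := by
    rw [← Matrix.add_mul, ← Matrix.mul_add, ← hLMN, h, ← Matrix.mul_assoc, ← Matrix.mul_assoc, hW,
      Matrix.one_mul, Matrix.mul_assoc, hW, Matrix.mul_one]
  rw [← Finset.sum_add_distrib]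
  refine Finset.sum_congr rfl fun i _ => ?_
  rw [← Matrix.add_apply, hd, Matrix.diagonal_apply_eq]

theorem Matrix.IsHermitian.sum_eigenvalues_le {M : Matrix ι ι ℝ} (hM : M.IsHermitian)
    (S : Finset ι) :
    ∑ i ∈ S, hM.eigenvalues i ≤
      ∑ i ∈ Finset.univ.filter (fun i : Fin (Fintype.card ι) => (i : ℕ) < S.card),
        hM.eigenvalues₀ i := by
  let e := (Fintype.equivOfCardEq (Fintype.card_fin _) : Fin (Fintype.card ι) ≃ ι)
  have h := hM.eigenvalues₀_antitone.sum_le_sum_initial (S.map e.symm.toEmbedding)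
  rw [Finset.sum_map, Finset.card_map] at h
  exact h

theorem Matrix.IsHermitian.exists_sum_eigenvalues_eq {M : Matrix ι ι ℝ} (hM : M.IsHermitian)
    (R : Finset (Fin (Fintype.card ι))) :
    ∃ T : Finset ι, T.card = R.card ∧ ∑ i ∈ T, hM.eigenvalues i = ∑ i ∈ R, hM.eigenvalues₀ i := by
  let e := (Fintype.equivOfCardEq (Fintype.card_fin _) : Fin (Fintype.card ι) ≃ ι)
  refine ⟨R.map e.toEmbedding, Finset.card_map _, ?_⟩
  rw [Finset.sum_map]
  refine Finset.sum_congr rfl fun i _ => ?_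
  exact congrArg hM.eigenvalues₀ (e.symm_apply_apply i)

theorem Matrix.IsHermitian.sum_eigenvalues₀ {M : Matrix ι ι ℝ} (hM : M.IsHermitian) :
    ∑ i, hM.eigenvalues₀ i = M.trace := by
  rw [hM.trace_eq_sum_eigenvalues]
  exact ((Fintype.equivOfCardEq (Fintype.card_fin _) :
    Fin (Fintype.card ι) ≃ ι).symm.sum_comp hM.eigenvalues₀).symm

end Diagonalization

/-! ### Truncated degree sums -/

section Conjugate

variable {ι : Type*} [Fintype ι]

theorem sum_min_succ (p : ι → ℕ) (k : ℕ) :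
    ∑ i, min (k + 1) (p i) = ∑ i, min k (p i) + conjugate p (k + 1) := by
  rw [conjugate, Finset.card_filter, ← Finset.sum_add_distrib]
  refine Finset.sum_congr rfl fun i _ => ?_
  split_ifs <;> omega

theorem sum_range_conjugate (p : ι → ℕ) (k : ℕ) :
    ∑ i ∈ Finset.range k, conjugate p (i + 1) = ∑ i, min k (p i) := by
  induction k with
  | zero => simp
  | succ k ih => rw [Finset.sum_range_succ, ih, sum_min_succ]

theorem conjugate_antitone (p : ι → ℕ) : Antitone (conjugate p) := fun _ _ h =>
  Finset.card_le_card (Finset.monotone_filter_right _ fun _ _ hi => h.trans hi)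

/-- Each unit step of the level up to `m` gains a conjugate term of index at most `m`. -/
theorem sum_min_add_mul_le {p : ι → ℕ} {a a' m : ℕ} (h : a ≤ a') (hm : a' ≤ m) :
    ∑ i, min a (p i) + (a' - a) * conjugate p m ≤ ∑ i, min a' (p i) := by
  induction a', h using Nat.le_induction with
  | base => simp
  | succ n hn ih =>
    rw [sum_min_succ, Nat.succ_sub hn, Nat.succ_mul]
    have := conjugate_antitone p hm
    have := ih (by omega)
    omega

theorem sum_min_le_add_mul (p : ι → ℕ) {b b' : ℕ} (h : b ≤ b') :
    ∑ i, min b' (p i) ≤ ∑ i, min b (p i) + (b' - b) * conjugate p 1 := by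
  induction b', h using Nat.le_induction with
  | base => simp
  | succ n hn ih =>
    rw [sum_min_succ, Nat.succ_sub hn, Nat.succ_mul]
    have := conjugate_antitone p (show 1 ≤ n + 1 by omega)
    omega

/-- Raising the level from `b` to `k` adds the conjugate terms of indices `b + 1, …, k`, which are
larger for `q`. -/
theorem sum_min_add_sum_min_le {κ : Type*} [Fintype κ] {p : ι → ℕ} {q : κ → ℕ}
    (hpq : ∀ i, 1 ≤ i → conjugate p i ≤ conjugate q i) {b k : ℕ} (h : b ≤ k) :
    ∑ i, min k (p i) + ∑ i, min b (q i) ≤ ∑ i, min b (p i) + ∑ i, min k (q i) := by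
  induction k, h using Nat.le_induction with
  | base => rfl
  | succ n hn ih =>
    rw [sum_min_succ p, sum_min_succ q]
    have := hpq (n + 1) (by omega)
    omega

variable {κ : Type*} [Fintype κ]

/-- If `m ≤ b` too, each `c v` fits in the slack between `a + b` and the level on its side, so the
bound is termwise. -/
theorem sum_min_union_le_of_le {p : ι → ℕ} {q : κ → ℕ} {c : ι ⊕ κ → ℕ} {a b m : ℕ}
    (hm : ∀ v, c v ≤ m) (hcq : ∀ i, 1 ≤ i → conjugate c i ≤ conjugate q i) (ha : m ≤ a) :
    ∑ i, min a (p i) + ∑ i, min b (q i) + ∑ v, c v ≤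
      ∑ v, min (a + b) (Sum.elim p q v + c v) := by
  rcases le_total m b with hb | hb
  · simp only [Fintype.sum_sum_type, Sum.elim_inl, Sum.elim_inr]
    have h1 : ∑ i, min a (p i) + ∑ i, c (.inl i) ≤ ∑ i, min (a + b) (p i + c (.inl i)) := by
      rw [← Finset.sum_add_distrib]
      refine Finset.sum_le_sum fun i _ => ?_
      have := hm (.inl i)
      omega
    have h2 : ∑ i, min b (q i) + ∑ i, c (.inr i) ≤ ∑ i, min (a + b) (q i + c (.inr i)) := by
      rw [← Finset.sum_add_distrib]
      refine Finset.sum_le_sum fun i _ => ?_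
      have := hm (.inr i)
      omega
    omega
  -- Trade levels: `c` drops from `m` to `b` while `q` rises from `b` to `m`. As `m ≤ a`, the bound
  -- is then termwise.
  · have h := sum_min_add_sum_min_le hcq hb
    have hc : ∑ v, min m (c v) = ∑ v, c v :=
      Finset.sum_congr rfl fun v _ => min_eq_right (hm v)
    rw [hc] at h
    have h3 : ∑ i, min a (p i) + ∑ i, min m (q i) + ∑ v, min b (c v) ≤
        ∑ v, min (a + b) (Sum.elim p q v + c v) := by
      simp only [Fintype.sum_sum_type, Sum.elim_inl, Sum.elim_inr]
      have h1 : ∑ i, min a (p i) + ∑ i, min b (c (.inl i)) ≤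
          ∑ i, min (a + b) (p i + c (.inl i)) := by
        rw [← Finset.sum_add_distrib]
        exact Finset.sum_le_sum fun i _ => by omega
      have h2 : ∑ i, min m (q i) + ∑ i, min b (c (.inr i)) ≤
          ∑ i, min (a + b) (q i + c (.inr i)) := by
        rw [← Finset.sum_add_distrib]
        exact Finset.sum_le_sum fun i _ => by omega
      omega
    omega

theorem sum_min_union_le {p : ι → ℕ} {q : κ → ℕ} {c : ι ⊕ κ → ℕ} {m : ℕ}
    (hm : ∀ v, c v ≤ m) (hcq : ∀ i, 1 ≤ i → conjugate c i ≤ conjugate q i)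
    (hqp : m ≠ 0 → conjugate q 1 ≤ conjugate p m) (a b : ℕ) :
    ∑ i, min a (p i) + ∑ i, min b (q i) + ∑ v, min (a + b) (c v) ≤
      ∑ v, min (a + b) (Sum.elim p q v + c v) := by
  rcases le_total m a with ha | ha
  · refine le_trans ?_ (sum_min_union_le_of_le hm hcq ha)
    gcongr
    exact min_le_right _ _
  rcases Nat.eq_zero_or_pos m with h0 | h0
  · refine le_trans ?_ (sum_min_union_le_of_le hm hcq (by omega))
    gcongr
    exact min_le_right _ _
  -- Now `a ≤ m`: moving one unit of level from `q` to `p` loses at most `conjugate q 1` and gains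
  -- at least `conjugate p m`.
  have hx := hqp h0.ne'
  rcases le_total (a + b) m with hk | hk
  -- Move all of `b` to `p`, then let `q` at level `a + b` absorb the `c` sum.
  · have h1 := sum_min_add_mul_le (p := p) (show a ≤ a + b by omega) hk
    have h2 := sum_min_le_add_mul q (Nat.zero_le b)
    have h3 := sum_min_add_sum_min_le hcq (Nat.zero_le (a + b))
    have h4 : b * conjugate q 1 ≤ b * conjugate p m := Nat.mul_le_mul_left b hx
    have h5 : ∑ i, min (a + b) (p i) + ∑ i, min (a + b) (q i) ≤
        ∑ v, min (a + b) (Sum.elim p q v + c v) := by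
      simp only [Fintype.sum_sum_type, Sum.elim_inl, Sum.elim_inr]
      gcongr <;> omega
    simp only [Nat.zero_min, Finset.sum_const_zero, Nat.sub_zero, Nat.add_sub_cancel_left]
      at h1 h2 h3
    omega
  -- Move `m - a` units, reaching the levels `m` and `a + b - m` of the case already settled.
  · have h1 := sum_min_add_mul_le (p := p) ha le_rfl
    have h2 := sum_min_le_add_mul q (show a + b - m ≤ b by omega)
    rw [show b - (a + b - m) = m - a by omega] at h2
    have h4 := Nat.mul_le_mul_left (m - a) hx
    have h5 := sum_min_union_le_of_le (p := p) (b := a + b - m) hm hcq le_rfl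
    rw [show m + (a + b - m) = a + b by omega] at h5
    have h6 : ∑ v, min (a + b) (c v) ≤ ∑ v, c v :=
      Finset.sum_le_sum fun v _ => min_le_right _ _
    omega

end Conjugate

/-! ### Laplacians and degrees of the union -/

namespace SimpleGraph

section

variable {V : Type*} [Fintype V]

theorem sum_conjDegree_initial (G : SimpleGraph V) [DecidableRel G.Adj] {k : ℕ}
    (hk : k ≤ Fintype.card V) :
    ∑ i ∈ Finset.univ.filter (fun i : Fin (Fintype.card V) => (i : ℕ) < k),
      (G.conjDegree ((i : ℕ) + 1) : ℝ) = ((∑ v, min k (G.degree v) : ℕ) : ℝ) := by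
  rw [Finset.sum_filter, Fin.sum_univ_eq_sum_range
    (fun i => if i < k then (G.conjDegree (i + 1) : ℝ) else 0), ← Finset.sum_filter,
    show (Finset.range (Fintype.card V)).filter (· < k) = Finset.range k by
      ext i; simp only [Finset.mem_filter, Finset.mem_range]; omega,
    ← sum_range_conjugate]
  push_cast
  rfl

theorem sum_conjDegree (G : SimpleGraph V) [DecidableRel G.Adj] :
    ∑ i : Fin (Fintype.card V), (G.conjDegree ((i : ℕ) + 1) : ℝ) =
      ((∑ v, G.degree v : ℕ) : ℝ) := by
  have h := G.sum_conjDegree_initial le_rfl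
  rw [Finset.filter_true_of_mem fun i _ => i.2] at h
  rw [h]
  congr 1
  exact Finset.sum_congr rfl fun v _ => min_eq_right (G.degree_lt_card_verts v).le

variable [DecidableEq V]

theorem sum_lapSpectrum (G : SimpleGraph V) [DecidableRel G.Adj] :
    ∑ i, G.lapSpectrum i = ((∑ v, G.degree v : ℕ) : ℝ) := by
  rw [lapSpectrum, Matrix.IsHermitian.sum_eigenvalues₀]
  simp [Matrix.trace, lapMatrix, degMatrix]

theorem GroneMerris.sum_eigenvalues_le {G : SimpleGraph V} [DecidableRel G.Adj]
    (h : G.GroneMerris) (S : Finset V) :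
    ∑ v ∈ S, (G.posSemidef_lapMatrix ℝ).isHermitian.eigenvalues v ≤
      ((∑ v, min S.card (G.degree v) : ℕ) : ℝ) := by
  refine (Matrix.IsHermitian.sum_eigenvalues_le _ S).trans ?_
  rw [← G.sum_conjDegree_initial S.card_le_univ]
  exact h.1 S.card S.card_le_univ

end

variable {α β : Type*} [Fintype α] [Fintype β]
  (A : SimpleGraph α) (B : SimpleGraph β) (C : SimpleGraph (α ⊕ β))
  [DecidableRel A.Adj] [DecidableRel B.Adj] [DecidableRel C.Adj]
  [DecidableRel ((A ⊕g B) ⊔ C).Adj]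

theorem degree_sum_sup (hC : C ≤ completeBipartiteGraph α β) (v : α ⊕ β) :
    ((A ⊕g B) ⊔ C).degree v = Sum.elim (fun x => A.degree x) (fun y => B.degree y) v +
      C.degree v := by
  have hl : ∀ x y, ¬ C.Adj (.inl x) (.inl y) := fun x y h => by simpa using hC h
  have hr : ∀ x y, ¬ C.Adj (.inr x) (.inr y) := fun x y h => by simpa using hC h
  cases v <;>
    simp only [degree, neighborFinset_eq_filter, Finset.card_filter, Fintype.sum_sum_type,
      Sum.elim_inl, Sum.elim_inr] <;> simp [hl, hr, add_comm]

theorem lapMatrix_sum_sup [DecidableEq α] [DecidableEq β]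
    (hC : C ≤ completeBipartiteGraph α β) :
    ((A ⊕g B) ⊔ C).lapMatrix ℝ =
      Matrix.fromBlocks (A.lapMatrix ℝ) 0 0 (B.lapMatrix ℝ) + C.lapMatrix ℝ := by
  have hl : ∀ x y, ¬ C.Adj (.inl x) (.inl y) := fun x y h => by simpa using hC h
  have hr : ∀ x y, ¬ C.Adj (.inr x) (.inr y) := fun x y h => by simpa using hC h
  ext v w
  rcases v with v | v <;> rcases w with w | w <;>
    simp [lapMatrix, degMatrix, Matrix.diagonal_apply, adjMatrix_apply,
      degree_sum_sup A B C hC, hl, hr] <;> split_ifs <;> ring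

end SimpleGraph

theorem theorem1 {α β : Type*} [Fintype α] [Fintype β] [DecidableEq α] [DecidableEq β]
    (A : SimpleGraph α) (B : SimpleGraph β) (C : SimpleGraph (α ⊕ β))
    [DecidableRel A.Adj] [DecidableRel B.Adj] [DecidableRel C.Adj]
    [DecidableRel ((A ⊕g B) ⊔ C).Adj]
    (hC : C ≤ completeBipartiteGraph α β)
    (hA_gm : A.GroneMerris) (hB_gm : B.GroneMerris) (hC_gm : C.GroneMerris)
    (hCA : ∀ i : ℕ, 1 ≤ i → C.conjDegree i ≤ A.conjDegree i)
    (hCB : ∀ i : ℕ, 1 ≤ i → C.conjDegree i ≤ B.conjDegree i)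
    (hBA : C ≠ ⊥ → B.conjDegree 1 ≤ A.conjDegree C.maxDegree) :
    ((A ⊕g B) ⊔ C).GroneMerris := by
  refine ⟨fun k hk => ?_, by rw [SimpleGraph.sum_lapSpectrum, SimpleGraph.sum_conjDegree]⟩
  rw [SimpleGraph.sum_conjDegree_initial _ hk]
  have hH := (((A ⊕g B) ⊔ C).posSemidef_lapMatrix ℝ).isHermitian
  obtain ⟨T, hT, hTsum⟩ := hH.exists_sum_eigenvalues_eq
    (Finset.univ.filter fun i : Fin (Fintype.card (α ⊕ β)) => (i : ℕ) < k)
  rw [Fin.card_filter_val_lt_of_le hk] at hT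
  refine hTsum.symm.trans_le ?_
  obtain ⟨S, S', hS, hS', hle⟩ :=
    ((A.posSemidef_lapMatrix ℝ).isHermitian.isOrthDiag_eigenvalues.fromBlocks
      (B.posSemidef_lapMatrix ℝ).isHermitian.isOrthDiag_eigenvalues).exists_sum_add_le
      (C.posSemidef_lapMatrix ℝ).isHermitian.isOrthDiag_eigenvalues
      hH.isOrthDiag_eigenvalues (SimpleGraph.lapMatrix_sum_sup A B C hC) T
  rw [hT] at hS hS'
  -- The split of `S` is not under control, hence the need for the counting inequality at all `a`
  -- and `b`.
  have hsplit : S.toLeft.card + S.toRight.card = k := by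
    rw [Finset.card_toLeft_add_card_toRight, hS]
  have h1 := hA_gm.sum_eigenvalues_le S.toLeft
  have h2 := hB_gm.sum_eigenvalues_le S.toRight
  have h3 := hC_gm.sum_eigenvalues_le S'
  rw [← S.toLeft_disjSum_toRight, Finset.sum_disjSum] at hle
  simp only [Sum.elim_inl, Sum.elim_inr] at hle
  have hbot : C.maxDegree ≠ 0 → B.conjDegree 1 ≤ A.conjDegree C.maxDegree := fun h => hBA <| by
    rintro rfl
    exact h (by simp)
  have hnat := sum_min_union_le (p := fun x => A.degree x) (q := fun y => B.degree y)
    (c := fun v => C.degree v) (fun v => C.degree_le_maxDegree v) hCB hbot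
    S.toLeft.card S.toRight.card
  simp only [hsplit, ← SimpleGraph.degree_sum_sup A B C hC] at hnat
  rw [hS'] at h3
  have hreal : ((∑ i, min S.toLeft.card (A.degree i) : ℕ) : ℝ) +
      ((∑ i, min S.toRight.card (B.degree i) : ℕ) : ℝ) +
      ((∑ v, min k (C.degree v) : ℕ) : ℝ) ≤
      ((∑ v, min k (((A ⊕g B) ⊔ C).degree v) : ℕ) : ℝ) := by exact_mod_cast hnat
  linarith
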